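/- Let $P_0,\dots,P_7\in\mathbb{R}^2$ be the consecutive vertices of a regular octagon, and let $v_k=P_{k+1}-P_k$ (indices mod $8$) be its eight edge vectors. Then there is a permutation $\sigma$ of the indices $0,\dots,7$ such that placing $v_{\sigma(0)},\dots,v_{\sigma(7)}$ tip to tail gives a closed plane polygon whose only self-intersections are exactly four transversal double points, each lying in the interiors of the two edges that cross there. Moreover, there are vectors $w_0,\dots,w_7\in\mathbb{R}^3$ with $\sum_k w_k=0$, where $w_k$ projects to $v_k$ under $(x,y,z)\mapsto(x,y)$, such that placing $w_{\sigma(0)},\dots,w_{\sigma(7)}$ tip to tail gives a closed polygon in $\mathbb{R}^3$ without self-intersections for which this four-crossing projection is alternating (overcrossings and undercrossings alternate as the polygon is traced), and this polygon is ambient isotopic in $\mathbb{R}^3$ to the figure-eight knot $4_1$. -/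

import Mathlib

/-- The vertices, in cyclic order, of a regular octagon in the plane, with centre `c` and
circumradius `r`, traversed counterclockwise (`ω = π / 4`) or clockwise (`ω = -(π / 4)`). -/
def IsRegularOctagon (P : Fin 8 → EuclideanSpace ℝ (Fin 2)) : Prop :=
  ∃ (c : EuclideanSpace ℝ (Fin 2)) (r θ ω : ℝ),
    0 < r ∧ (ω = Real.pi / 4 ∨ ω = -(Real.pi / 4)) ∧
    ∀ k : Fin 8, P k =
      c + r • !₂[Real.cos (θ + ((k : ℕ) : ℝ) * ω), Real.sin (θ + ((k : ℕ) : ℝ) * ω)]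

/-- The vertices obtained by placing vectors tip to tail, in the given order, starting at `0`.
If the vectors sum to `0`, the successive edges of the closed polygon with these vertices
are the vectors. -/
def tipToTail {E : Type*} [AddCommGroup E] {n : ℕ} (v : Fin n → E) (k : Fin n) : E :=
  ∑ j ∈ Finset.Iio k, v j

/-- The point at position `p.2` on the edge from vertex `p.1` to the (cyclically) next vertex
of the closed polygon with vertices `Q`. -/
def polyPoint {E : Type*} [AddCommGroup E] [Module ℝ E] {n : ℕ} [NeZero n]
    (Q : Fin n → E) (p : Fin n × ℝ) : E :=
  (1 - p.2) • Q p.1 + p.2 • Q (p.1 + 1)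

/-- The parameters of a closed polygon with `n` edges: each position along the closed polygon
is listed once (the end of an edge is the start of the next one). -/
def polyParams (n : ℕ) : Set (Fin n × ℝ) := {p | 0 ≤ p.2 ∧ p.2 < 1}

/-- The closed polygon with vertices `Q`, as a set of points. -/
def polygon {E : Type*} [AddCommGroup E] [Module ℝ E] {n : ℕ} [NeZero n]
    (Q : Fin n → E) : Set E :=
  polyPoint Q '' polyParams n

/-- The closed polygon has no self-intersections; in space this says that it is a polygonal
knot. -/
def IsSimplePolygon {E : Type*} [AddCommGroup E] [Module ℝ E] {n : ℕ} [NeZero n]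
    (Q : Fin n → E) : Prop :=
  Set.InjOn (polyPoint Q) (polyParams n)

/-- The vertical projection of space to the plane. -/
def proj (x : EuclideanSpace ℝ (Fin 3)) : EuclideanSpace ℝ (Fin 2) := !₂[x 0, x 1]

/-- The points of the plane through which the closed polygon passes more than once. -/
def crossings {n : ℕ} [NeZero n] (P : Fin n → EuclideanSpace ℝ (Fin 2)) :
    Set (EuclideanSpace ℝ (Fin 2)) :=
  {x | ∃ p ∈ polyParams n, ∃ q ∈ polyParams n, p ≠ q ∧ polyPoint P p = x ∧ polyPoint P q = x}

/-- A regular (generic) closed plane polygon: its only self-intersections are transversal double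
points in the interiors of two edges. -/
def IsRegularProjection {n : ℕ} [NeZero n] (P : Fin n → EuclideanSpace ℝ (Fin 2)) : Prop :=
  ∀ p ∈ polyParams n, ∀ q ∈ polyParams n, p ≠ q → polyPoint P p = polyPoint P q →
    p.2 ≠ 0 ∧ q.2 ≠ 0 ∧
    LinearIndependent ℝ ![P (p.1 + 1) - P p.1, P (q.1 + 1) - P q.1] ∧
    ∀ s ∈ polyParams n, polyPoint P s = polyPoint P p → s = p ∨ s = q

/-- At the parameter `p`, the space polygon passes over another of its strands. -/
def IsOver {n : ℕ} [NeZero n] (Q : Fin n → EuclideanSpace ℝ (Fin 3)) (p : Fin n × ℝ) : Prop :=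
  p ∈ polyParams n ∧ ∃ q ∈ polyParams n, p ≠ q ∧
    proj (polyPoint Q p) = proj (polyPoint Q q) ∧ polyPoint Q q 2 < polyPoint Q p 2

/-- At the parameter `p`, the space polygon passes under another of its strands. -/
def IsUnder {n : ℕ} [NeZero n] (Q : Fin n → EuclideanSpace ℝ (Fin 3)) (p : Fin n × ℝ) : Prop :=
  p ∈ polyParams n ∧ ∃ q ∈ polyParams n, p ≠ q ∧
    proj (polyPoint Q p) = proj (polyPoint Q q) ∧ polyPoint Q p 2 < polyPoint Q q 2

/-- `p` comes before `q` when the closed polygon is traced once from its vertex `0`. -/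
def Before {n : ℕ} (p q : Fin n × ℝ) : Prop :=
  p.1 < q.1 ∨ (p.1 = q.1 ∧ p.2 < q.2)

/-- The diagram of the space polygon is alternating: tracing around the closed polygon, there are
never two consecutive overcrossings or two consecutive undercrossings. In other words, any two
distinct overcrossings are separated by undercrossings on both of the arcs that they bound, and
conversely. -/
def IsAlternating {n : ℕ} [NeZero n] (Q : Fin n → EuclideanSpace ℝ (Fin 3)) : Prop :=
  ∀ p q : Fin n × ℝ, Before p q →
    (IsOver Q p → IsOver Q q →
      (∃ s, IsUnder Q s ∧ Before p s ∧ Before s q) ∧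
      (∃ s, IsUnder Q s ∧ (Before s p ∨ Before q s))) ∧
    (IsUnder Q p → IsUnder Q q →
      (∃ s, IsOver Q s ∧ Before p s ∧ Before s q) ∧
      (∃ s, IsOver Q s ∧ (Before s p ∨ Before q s)))

/-- Two subsets of space are ambient isotopic. -/
def AmbientIsotopic (K L : Set (EuclideanSpace ℝ (Fin 3))) : Prop :=
  ∃ H : unitInterval → (EuclideanSpace ℝ (Fin 3) ≃ₜ EuclideanSpace ℝ (Fin 3)),
    Continuous (fun p : unitInterval × EuclideanSpace ℝ (Fin 3) => H p.1 p.2) ∧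
    (∀ x, H 0 x = x) ∧ H 1 '' K = L

/-- The vertices of a standard polygonal figure-eight knot. Its vertical projection is a reduced
alternating diagram with four crossings: with edge `i` going from vertex `i` to vertex `i + 1`,
the crossings met when tracing the polygon are, in order,
`X` (edge 1, over), `Y` (edge 1, under), `Z` (edge 3, over), `W` (edge 4, under),
`Y` (edge 4, over), `X` (edge 6, under), `W` (edge 6, over), `Z` (edge 7, under),
where `X = (3, 1)`, `Y = (3, 2)`, `Z = (3/2, 3/2)` and `W = (5/2, 3/2)`; its
Dowker-Thistlethwaite code is `6 8 2 4`, or `4 6 8 2` if one starts at the last passage. -/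
def figureEightVertices : Fin 8 → EuclideanSpace ℝ (Fin 3) :=
  ![!₂[0, 0, -1], !₂[3, 0, 3], !₂[3, 3, -3], !₂[0, 3, 1],
    !₂[2, 1, 0], !₂[4, 3, -1], !₂[4, 0, 1], !₂[2, 2, 0]]

/-- `K` is a figure-eight knot `4₁`. (This knot is isotopic to its mirror image and to its
reverse, so neither the chirality of the model nor an orientation matters.) -/
def IsFigureEightKnot (K : Set (EuclideanSpace ℝ (Fin 3))) : Prop :=
  AmbientIsotopic K (polygon figureEightVertices)

/-! Place the edges of a counterclockwise octagon in the order 0, 2, 4, 7, 1, 6, 3, 5. After a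
rotation and scaling the resulting plane polygon has vertices in `ℤ[√2]` and four crossings, and
suitable integer heights lift it to `octagonKnot`, whose crossings and their over/under pattern
match those of `figureEightVertices`.

The isotopy to the model is the straight-line motion of the vertices. For every pair of edges a
single integer functional separates the two edges in both polygons, hence in all convex combinations
(`isSeparatedPolygon_octagonKnot_segment`). Such separation is quantitative: a small displacement of
the vertices moves the points of the polygon by a map with small Lipschitz constant. Extended to all
of space and added to the identity, this map gives an ambient isotopy
(`IsSeparatedPolygon.exists_ambientIsotopic`). So isotopy classes are locally constant in families
of separated polygons, and constant over preconnected parameter sets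
(`ambientIsotopic_of_isPreconnected`).

Any regular octagon has, after renumbering if it is clockwise, the same edge vectors up to
multiplication by some complex `z ≠ 0`. Since `ℂ \ {0}` is connected, the same principle carries the
knot type to every `z`; the diagram statements transfer because `rotPlane z` is injective and
heights are untouched. -/

/-! ### Ambient isotopies of space. -/

theorem AmbientIsotopic.trans {K L M : Set (EuclideanSpace ℝ (Fin 3))}
    (h₁ : AmbientIsotopic K L) (h₂ : AmbientIsotopic L M) : AmbientIsotopic K M := by
  obtain ⟨H, hc, h0, h1⟩ := h₁
  obtain ⟨G, gc, g0, g1⟩ := h₂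
  refine ⟨fun t => (H t).trans (G t), ?_, fun x => by simp [h0, g0], ?_⟩
  · exact gc.comp (continuous_fst.prodMk hc)
  · rw [← g1, ← h1, Set.image_image]
    rfl

theorem AmbientIsotopic.symm {K L : Set (EuclideanSpace ℝ (Fin 3))}
    (h : AmbientIsotopic K L) : AmbientIsotopic L K := by
  obtain ⟨H, hc, h0, h1⟩ := h
  -- Undoing `H 1` and then running `H` backwards inverts only one homeomorphism, so joint
  -- continuity of the inverses of all `H t` is not needed.
  refine ⟨fun t => (H 1).symm.trans (H (unitInterval.symm t)), ?_, fun x => by simp, ?_⟩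
  · exact hc.comp ((unitInterval.continuous_symm.comp continuous_fst).prodMk
      ((H 1).symm.continuous.comp continuous_snd))
  · rw [← h1, Set.image_image]
    simp [h0]

/-- Adding to the identity a Lipschitz map with constant less than `1` is an ambient isotopy. -/
theorem ambientIsotopic_image_add_of_lipschitzWith {C : NNReal} (hC : C < 1)
    {f : EuclideanSpace ℝ (Fin 3) → EuclideanSpace ℝ (Fin 3)} (hf : LipschitzWith C f)
    (K : Set (EuclideanSpace ℝ (Fin 3))) : AmbientIsotopic K ((fun x => x + f x) '' K) := by
  -- For each `t` the map stays within Lipschitz distance `C < 1` of the identity, so the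
  -- quantitative inverse function theorem makes it a homeomorphism of the whole space.
  have key (t : unitInterval) : ApproximatesLinearOn (fun x => x + (t : ℝ) • f x)
      ((ContinuousLinearEquiv.refl ℝ (EuclideanSpace ℝ (Fin 3)) :
        EuclideanSpace ℝ (Fin 3) →L[ℝ] EuclideanSpace ℝ (Fin 3))) Set.univ C := by
    intro x _ y _
    have h : x + (t : ℝ) • f x - (y + (t : ℝ) • f y) - (x - y) = (t : ℝ) • (f x - f y) := by
      module
    simp only [ContinuousLinearEquiv.coe_coe, ContinuousLinearEquiv.refl_apply, h, norm_smul]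
    calc ‖(t : ℝ)‖ * ‖f x - f y‖ ≤ 1 * ‖f x - f y‖ := by
          gcongr
          rw [Real.norm_eq_abs, abs_of_nonneg t.2.1]
          exact t.2.2
      _ ≤ C * ‖x - y‖ := by simpa using hf.norm_sub_le x y
  have hN : C < ‖((ContinuousLinearEquiv.refl ℝ (EuclideanSpace ℝ (Fin 3))).symm :
      EuclideanSpace ℝ (Fin 3) →L[ℝ] EuclideanSpace ℝ (Fin 3))‖₊⁻¹ := by
    have h1 : ‖((ContinuousLinearEquiv.refl ℝ (EuclideanSpace ℝ (Fin 3))).symm :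
        EuclideanSpace ℝ (Fin 3) →L[ℝ] EuclideanSpace ℝ (Fin 3))‖₊ = 1 :=
      nnnorm_one (G := EuclideanSpace ℝ (Fin 3) →L[ℝ] EuclideanSpace ℝ (Fin 3))
    simpa [h1] using hC
  refine ⟨fun t => (key t).toHomeomorph _ (Or.inr hN), ?_, fun x => ?_, ?_⟩
  · change Continuous fun p : unitInterval × EuclideanSpace ℝ (Fin 3) =>
      p.2 + (p.1 : ℝ) • f p.2
    have := hf.continuous
    fun_prop
  · change x + ((0 : unitInterval) : ℝ) • f x = x
    simp
  · change (fun x => x + ((1 : unitInterval) : ℝ) • f x) '' K = _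
    simp

/-! ### Polygons whose edges are separated by linear functionals. -/

section polygons

variable {E : Type*} [AddCommGroup E] [Module ℝ E] {n : ℕ} [NeZero n]

/-- A linear functional separates the edges `i` and `j` of the closed polygon `Q`, except for a
vertex that they share. -/
def SeparatedEdges (Q : Fin n → E) (i j : Fin n) : Prop :=
  ∃ f : E →ₗ[ℝ] ℝ, ∀ a, a = i ∨ a = i + 1 → ∀ b, b = j ∨ b = j + 1 → a ≠ b → f (Q a) < f (Q b)

/-- Any two edges of the closed polygon are separated by a linear functional. -/
def IsSeparatedPolygon (Q : Fin n → E) : Prop :=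
  ∀ i j, i < j → SeparatedEdges Q i j

theorem polyPoint_comp {F : Type*} [AddCommGroup F] [Module ℝ F] (A : E →ₗ[ℝ] F)
    (Q : Fin n → E) (p : Fin n × ℝ) : polyPoint (fun k => A (Q k)) p = A (polyPoint Q p) := by
  simp [polyPoint]

theorem polyPoint_add (Q R : Fin n → E) (p : Fin n × ℝ) :
    polyPoint (fun k => Q k + R k) p = polyPoint Q p + polyPoint R p := by
  simp only [polyPoint]
  module

theorem SeparatedEdges.comp {F : Type*} [AddCommGroup F] [Module ℝ F] {A : E →ₗ[ℝ] F}
    (hA : Function.Injective A) {Q : Fin n → E} {i j : Fin n} (h : SeparatedEdges Q i j) :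
    SeparatedEdges (fun k => A (Q k)) i j := by
  obtain ⟨B, hB⟩ := A.exists_leftInverse_of_injective (LinearMap.ker_eq_bot.2 hA)
  obtain ⟨f, hf⟩ := h
  refine ⟨f ∘ₗ B, fun a ha b hb hab => ?_⟩
  have hB' (x : E) : B (A x) = x := LinearMap.congr_fun hB x
  simpa [hB'] using hf a ha b hb hab

theorem polyPoint_sub_polyPoint (Q : Fin n → E) (p q : Fin n × ℝ) :
    polyPoint Q q - polyPoint Q p =
      ((1 - p.2) * (1 - q.2)) • (Q q.1 - Q p.1) + ((1 - p.2) * q.2) • (Q (q.1 + 1) - Q p.1) +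
      (p.2 * (1 - q.2)) • (Q q.1 - Q (p.1 + 1)) + (p.2 * q.2) • (Q (q.1 + 1) - Q (p.1 + 1)) := by
  simp only [polyPoint]
  module

theorem polyPoint_sub_polyPoint_same (Q : Fin n → E) (i : Fin n) (s t : ℝ) :
    polyPoint Q (i, t) - polyPoint Q (i, s) = (t - s) • (Q (i + 1) - Q i) := by
  simp only [polyPoint]
  module

/-- In the expansion of `polyPoint_sub_polyPoint` all four terms are nonnegative under `f`. The
first is strictly positive because parameters are below `1` and the starting vertices differ. -/
theorem SeparatedEdges.polyPoint_ne {Q : Fin n → E} {p q : Fin n × ℝ}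
    (h : SeparatedEdges Q p.1 q.1) (hne : p.1 ≠ q.1) (hp : p ∈ polyParams n)
    (hq : q ∈ polyParams n) : polyPoint Q p ≠ polyPoint Q q := by
  obtain ⟨f, hf⟩ := h
  obtain ⟨hp0, hp1⟩ := hp
  obtain ⟨hq0, hq1⟩ := hq
  have hf' (a b : Fin n) (ha : a = p.1 ∨ a = p.1 + 1) (hb : b = q.1 ∨ b = q.1 + 1) :
      0 ≤ f (Q b) - f (Q a) := by
    rcases eq_or_ne a b with rfl | hab
    · simp
    · exact (sub_pos.2 (hf a ha b hb hab)).le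
  intro he
  have h0 := congrArg f (polyPoint_sub_polyPoint Q p q)
  rw [he, sub_self] at h0
  simp only [map_zero, map_add, map_smul, map_sub, smul_eq_mul] at h0
  have h1 := mul_pos (mul_pos (sub_pos.2 hp1) (sub_pos.2 hq1))
    (sub_pos.2 (hf p.1 (Or.inl rfl) q.1 (Or.inl rfl) hne))
  have h2 := mul_nonneg (mul_nonneg (sub_pos.2 hp1).le hq0)
    (hf' p.1 (q.1 + 1) (Or.inl rfl) (Or.inr rfl))
  have h3 := mul_nonneg (mul_nonneg hp0 (sub_pos.2 hq1).le)
    (hf' (p.1 + 1) q.1 (Or.inr rfl) (Or.inl rfl))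
  have h4 := mul_nonneg (mul_nonneg hp0 hq0) (hf' (p.1 + 1) (q.1 + 1) (Or.inr rfl) (Or.inr rfl))
  linarith

theorem polyPoint_injective_edge {Q : Fin n → E} {i : Fin n} (h : Q i ≠ Q (i + 1)) {s t : ℝ}
    (he : polyPoint Q (i, s) = polyPoint Q (i, t)) : s = t := by
  have h1 := polyPoint_sub_polyPoint_same Q i s t
  rw [he, sub_self, eq_comm, smul_eq_zero, sub_eq_zero, sub_eq_zero] at h1
  rcases h1 with h1 | h1
  · exact h1.symm
  · exact absurd h1.symm h

end polygons

/-! ### Stability of separated polygons under motion of the vertices. -/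

section isotopy

variable {E : Type*} [NormedAddCommGroup E] [NormedSpace ℝ E] [FiniteDimensional ℝ E]
  {n : ℕ} [NeZero n]

/-- Both differences are the same nonnegative combination of four vertex differences. For distinct
vertices `f` has a positive gap, which dominates the displacement `2 * D`; at a shared vertex both
sides vanish. Summing bounds the left side by a multiple of `f` of the difference in `Q`, hence of
its norm. -/
theorem SeparatedEdges.exists_norm_polyPoint_sub_le {Q : Fin n → E} {i j : Fin n}
    (h : SeparatedEdges Q i j) : ∃ C : ℝ, 0 ≤ C ∧ ∀ (δ : Fin n → E) (D : ℝ), (∀ k, ‖δ k‖ ≤ D) →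
      ∀ s ∈ Set.Icc (0 : ℝ) 1, ∀ t ∈ Set.Icc (0 : ℝ) 1,
        ‖polyPoint δ (j, t) - polyPoint δ (i, s)‖ ≤
          C * D * ‖polyPoint Q (j, t) - polyPoint Q (i, s)‖ := by
  obtain ⟨f, hf⟩ := h
  have hpair (a b : Fin n) (ha : a = i ∨ a = i + 1) (hb : b = j ∨ b = j + 1) :
      ∃ c : ℝ, 0 ≤ c ∧ ∀ (δ : Fin n → E) (D : ℝ), (∀ k, ‖δ k‖ ≤ D) →
        ‖δ b - δ a‖ ≤ c * D * (f (Q b) - f (Q a)) := by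
    rcases eq_or_ne a b with rfl | hab
    · exact ⟨0, le_rfl, fun δ D _ => by simp⟩
    · have hm := sub_pos.2 (hf a ha b hb hab)
      refine ⟨2 / (f (Q b) - f (Q a)), by positivity, fun δ D hD => ?_⟩
      calc ‖δ b - δ a‖ ≤ D + D := (norm_sub_le _ _).trans (add_le_add (hD b) (hD a))
        _ = _ := by field_simp; ring
  have hmono (a b : Fin n) (ha : a = i ∨ a = i + 1) (hb : b = j ∨ b = j + 1) :
      0 ≤ f (Q b) - f (Q a) := by
    rcases eq_or_ne a b with rfl | hab
    · simp
    · exact (sub_pos.2 (hf a ha b hb hab)).le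
  obtain ⟨c₁, h₁, k₁⟩ := hpair i j (Or.inl rfl) (Or.inl rfl)
  obtain ⟨c₂, h₂, k₂⟩ := hpair i (j + 1) (Or.inl rfl) (Or.inr rfl)
  obtain ⟨c₃, h₃, k₃⟩ := hpair (i + 1) j (Or.inr rfl) (Or.inl rfl)
  obtain ⟨c₄, h₄, k₄⟩ := hpair (i + 1) (j + 1) (Or.inr rfl) (Or.inr rfl)
  have m₁ := hmono i j (Or.inl rfl) (Or.inl rfl)
  have m₂ := hmono i (j + 1) (Or.inl rfl) (Or.inr rfl)
  have m₃ := hmono (i + 1) j (Or.inr rfl) (Or.inl rfl)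
  have m₄ := hmono (i + 1) (j + 1) (Or.inr rfl) (Or.inr rfl)
  set c := c₁ + c₂ + c₃ + c₄ with hc
  have hc0 : 0 ≤ c := by positivity
  set φ := LinearMap.toContinuousLinearMap f
  refine ⟨c * ‖φ‖, by positivity, fun δ D hD s hs t ht => ?_⟩
  have hD0 : 0 ≤ D := (norm_nonneg _).trans (hD 0)
  have hs' : 0 ≤ 1 - s := sub_nonneg.2 hs.2
  have ht' : 0 ≤ 1 - t := sub_nonneg.2 ht.2
  have hs0 := hs.1
  have ht0 := ht.1
  have bound {x y c' : ℝ} (hx : x ≤ c' * D * y) (hy : 0 ≤ y) (hle : c' ≤ c) : x ≤ c * D * y :=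
    hx.trans (by gcongr)
  calc ‖polyPoint δ (j, t) - polyPoint δ (i, s)‖
      ≤ (1 - s) * (1 - t) * (c * D * (f (Q j) - f (Q i))) +
        (1 - s) * t * (c * D * (f (Q (j + 1)) - f (Q i))) +
        s * (1 - t) * (c * D * (f (Q j) - f (Q (i + 1)))) +
        s * t * (c * D * (f (Q (j + 1)) - f (Q (i + 1)))) := by
        rw [polyPoint_sub_polyPoint]
        refine (norm_add₄_le ..).trans ?_
        simp only [norm_smul, norm_mul, Real.norm_of_nonneg hs', Real.norm_of_nonneg ht',
          Real.norm_of_nonneg hs0, Real.norm_of_nonneg ht0]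
        gcongr
        · exact bound (k₁ δ D hD) m₁ (by linarith)
        · exact bound (k₂ δ D hD) m₂ (by linarith)
        · exact bound (k₃ δ D hD) m₃ (by linarith)
        · exact bound (k₄ δ D hD) m₄ (by linarith)
    _ = c * D * φ (polyPoint Q (j, t) - polyPoint Q (i, s)) := by
        rw [polyPoint_sub_polyPoint]
        simp only [map_add, map_smul, map_sub, smul_eq_mul, φ, LinearMap.coe_toContinuousLinearMap']
        ring
    _ ≤ c * D * (‖φ‖ * ‖polyPoint Q (j, t) - polyPoint Q (i, s)‖) := by
        gcongr
        exact (le_abs_self _).trans (φ.le_opNorm _)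
    _ = _ := by ring

theorem IsSeparatedPolygon.exists_norm_polyPoint_sub_le {Q : Fin n → E}
    (h : IsSeparatedPolygon Q) (hQ : ∀ i, Q i ≠ Q (i + 1)) :
    ∃ C : ℝ, 0 < C ∧ ∀ (δ : Fin n → E) (D : ℝ), (∀ k, ‖δ k‖ ≤ D) →
      ∀ p ∈ polyParams n, ∀ q ∈ polyParams n,
        ‖polyPoint δ q - polyPoint δ p‖ ≤ C * D * ‖polyPoint Q q - polyPoint Q p‖ := by
  have hpair (i j : Fin n) : ∃ C : ℝ, 0 ≤ C ∧ ∀ (δ : Fin n → E) (D : ℝ), (∀ k, ‖δ k‖ ≤ D) →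
      ∀ s ∈ Set.Icc (0 : ℝ) 1, ∀ t ∈ Set.Icc (0 : ℝ) 1,
        ‖polyPoint δ (j, t) - polyPoint δ (i, s)‖ ≤
          C * D * ‖polyPoint Q (j, t) - polyPoint Q (i, s)‖ := by
    rcases lt_trichotomy i j with hij | rfl | hij
    · exact (h i j hij).exists_norm_polyPoint_sub_le
    · have hd : 0 < ‖Q (i + 1) - Q i‖ := norm_pos_iff.2 (sub_ne_zero.2 (hQ i).symm)
      refine ⟨2 / ‖Q (i + 1) - Q i‖, by positivity, fun δ D hD s _ t _ => ?_⟩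
      rw [polyPoint_sub_polyPoint_same, polyPoint_sub_polyPoint_same, norm_smul, norm_smul]
      calc ‖t - s‖ * ‖δ (i + 1) - δ i‖ ≤ ‖t - s‖ * (D + D) := by
            gcongr
            exact (norm_sub_le _ _).trans (add_le_add (hD _) (hD _))
        _ = _ := by field_simp; ring
    · obtain ⟨C, hC, k⟩ := (h j i hij).exists_norm_polyPoint_sub_le
      refine ⟨C, hC, fun δ D hD s hs t ht => ?_⟩
      rw [norm_sub_rev, norm_sub_rev (polyPoint Q _)]
      exact k δ D hD t ht s hs
  choose C hC k using hpair
  -- The summand `1` makes the constant strictly positive.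
  refine ⟨1 + ∑ i, ∑ j, C i j, ?_, fun δ D hD p hp q hq => ?_⟩
  · have : 0 ≤ ∑ i, ∑ j, C i j := Finset.sum_nonneg fun i _ => Finset.sum_nonneg fun j _ => hC i j
    linarith
  · have hD0 : 0 ≤ D := (norm_nonneg _).trans (hD 0)
    refine (k p.1 q.1 δ D hD p.2 ⟨hp.1, hp.2.le⟩ q.2 ⟨hq.1, hq.2.le⟩).trans ?_
    have h1 : C p.1 q.1 ≤ ∑ j, C p.1 j :=
      Finset.single_le_sum (f := fun j => C p.1 j) (fun j _ => hC _ j) (Finset.mem_univ q.1)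
    have h2 : ∑ j, C p.1 j ≤ ∑ i, ∑ j, C i j :=
      Finset.single_le_sum (f := fun i => ∑ j, C i j)
        (fun i _ => Finset.sum_nonneg fun j _ => hC i j) (Finset.mem_univ p.1)
    gcongr
    linarith

/-- Moving the vertices of a separated polygon a little is an ambient isotopy. -/
theorem IsSeparatedPolygon.exists_ambientIsotopic {Q : Fin n → EuclideanSpace ℝ (Fin 3)}
    (h : IsSeparatedPolygon Q) (hQ : ∀ i, Q i ≠ Q (i + 1)) :
    ∃ ε > 0, ∀ Q' : Fin n → EuclideanSpace ℝ (Fin 3), dist Q' Q < ε →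
      AmbientIsotopic (polygon Q) (polygon Q') := by
  obtain ⟨C, hC, key⟩ := h.exists_norm_polyPoint_sub_le hQ
  set c := lipschitzExtensionConstant (EuclideanSpace ℝ (Fin 3)) with hc
  have hc0 : 0 < c := lipschitzExtensionConstant_pos _
  refine ⟨(2 * (C * c))⁻¹, by positivity, fun Q' hQ' => ?_⟩
  set D := dist Q' Q with hDdef
  set δ : Fin n → EuclideanSpace ℝ (Fin 3) := fun k => Q' k - Q k with hδ
  have hD (k : Fin n) : ‖δ k‖ ≤ D := by
    rw [hδ, ← dist_eq_norm]
    exact dist_le_pi_dist Q' Q k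
  classical
  let g : EuclideanSpace ℝ (Fin 3) → EuclideanSpace ℝ (Fin 3) := fun x =>
    if hx : x ∈ polygon Q then polyPoint δ hx.choose else 0
  -- The displacement does not depend on the parameter chosen: where two points of `Q` agree, `key`
  -- bounds the difference of displacements by zero.
  have hg (p : Fin n × ℝ) (hp : p ∈ polyParams n) : g (polyPoint Q p) = polyPoint δ p := by
    have hx : polyPoint Q p ∈ polygon Q := ⟨p, hp, rfl⟩
    simp only [g, dif_pos hx]
    have := key δ D hD p hp _ hx.choose_spec.1
    rw [hx.choose_spec.2, sub_self, norm_zero, mul_zero] at this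
    exact sub_eq_zero.1 (norm_le_zero_iff.1 this)
  have hlip : LipschitzOnWith (C * D).toNNReal g (polygon Q) := by
    refine LipschitzOnWith.of_dist_le_mul ?_
    rintro _ ⟨p, hp, rfl⟩ _ ⟨q, hq, rfl⟩
    rw [hg p hp, hg q hq, dist_eq_norm, dist_eq_norm,
      Real.coe_toNNReal _ (mul_nonneg hC.le dist_nonneg)]
    exact key δ D hD q hq p hp
  obtain ⟨G, hG, hGg⟩ := hlip.extend_finite_dimension
  have hlt : c * (C * D).toNNReal < 1 := by
    rw [← NNReal.coe_lt_coe, NNReal.coe_mul, Real.coe_toNNReal _ (mul_nonneg hC.le dist_nonneg),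
      NNReal.coe_one]
    have h2 : (c : ℝ) * (C * D) ≤ (C * c) * (2 * (C * c))⁻¹ := by
      rw [mul_left_comm, ← mul_assoc]
      gcongr
    have h3 : (C * c) * (2 * (C * c))⁻¹ = 1 / 2 := by
      have : (c : ℝ) ≠ 0 := by positivity
      field_simp
    linarith
  have hiso := ambientIsotopic_image_add_of_lipschitzWith hlt hG (polygon Q)
  have himage : (fun x => x + G x) '' polygon Q = polygon Q' := by
    rw [polygon, polygon, Set.image_image]
    refine Set.image_congr fun p hp => ?_
    rw [← hGg ⟨p, hp, rfl⟩, hg p hp, ← polyPoint_add]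
    simp [hδ]
  rwa [himage] at hiso

/-- A continuous family of separated polygons over a preconnected set is an ambient isotopy. -/
theorem ambientIsotopic_of_isPreconnected {X : Type*} [TopologicalSpace X] {S : Set X}
    (hS : IsPreconnected S) {Q : X → Fin n → EuclideanSpace ℝ (Fin 3)} (hc : Continuous Q)
    (h : ∀ x ∈ S, IsSeparatedPolygon (Q x)) (hQ : ∀ x ∈ S, ∀ i, Q x i ≠ Q x (i + 1))
    {x y : X} (hx : x ∈ S) (hy : y ∈ S) : AmbientIsotopic (polygon (Q x)) (polygon (Q y)) := by
  refine hS.induction₂' (fun x y => AmbientIsotopic (polygon (Q x)) (polygon (Q y)))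
    (fun x hx => ?_) (fun x y z _ _ _ => AmbientIsotopic.trans) hx hy
  obtain ⟨ε, hε, hiso⟩ := (h x hx).exists_ambientIsotopic (hQ x hx)
  have := (hc.tendsto x).eventually (Metric.ball_mem_nhds (Q x) hε)
  filter_upwards [nhdsWithin_le_nhds this] with y hy
  exact ⟨hiso _ hy, (hiso _ hy).symm⟩

end isotopy

theorem IsSeparatedPolygon.injective {E : Type*} [AddCommGroup E] [Module ℝ E] {n : ℕ} [NeZero n]
    {Q : Fin n → E} (h : IsSeparatedPolygon Q) : Function.Injective Q := by
  have key (i j : Fin n) (hij : i < j) : Q i ≠ Q j := fun he => by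
    obtain ⟨f, hf⟩ := h i j hij
    exact (hf i (Or.inl rfl) j (Or.inl rfl) hij.ne).ne (congrArg f he)
  intro i j he
  by_contra hij
  rcases lt_or_gt_of_ne hij with hij | hij
  · exact key i j hij he
  · exact key j i hij he.symm

theorem IsSeparatedPolygon.ne_add_one {E : Type*} [AddCommGroup E] [Module ℝ E]
    {Q : Fin 8 → E} (h : IsSeparatedPolygon Q) (i : Fin 8) : Q i ≠ Q (i + 1) :=
  h.injective.ne (by revert i; decide)

/-! ### Integer certificates for inequalities in `ℤ[√2]`. -/

section quadraticPoints

variable {d : ℕ}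

/-- The point of `ℝᵈ` with coordinates `A c + B c √2`. -/
noncomputable def quadraticPoint (A B : Fin d → ℤ) : EuclideanSpace ℝ (Fin d) :=
  WithLp.toLp 2 fun c => (A c : ℝ) + B c * √2

/-- The linear functional on `ℝᵈ` with integer coefficients `F`. -/
noncomputable def integerFunctional (F : Fin d → ℤ) : EuclideanSpace ℝ (Fin d) →ₗ[ℝ] ℝ :=
  ∑ c, (F c : ℝ) • EuclideanSpace.projₗ c

theorem integerFunctional_quadraticPoint (F A B : Fin d → ℤ) :
    integerFunctional F (quadraticPoint A B) =
      ((∑ c, F c * A c : ℤ) : ℝ) + ((∑ c, F c * B c : ℤ) : ℝ) * √2 := by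
  simp [integerFunctional, quadraticPoint, mul_add, Finset.sum_add_distrib, Finset.sum_mul,
    mul_assoc]

/-- An integral certificate that `a + b √2 < a' + b' √2`, from `7 / 5 < √2 < 3 / 2`. -/
theorem quadratic_lt_of_int {a b a' b' : ℤ} (h₁ : 5 * a + 7 * b < 5 * a' + 7 * b')
    (h₂ : 2 * a + 3 * b < 2 * a' + 3 * b') : (a : ℝ) + b * √2 < a' + b' * √2 := by
  have h₁' : (5 * a + 7 * b : ℝ) < 5 * a' + 7 * b' := by exact_mod_cast h₁
  have h₂' : (2 * a + 3 * b : ℝ) < 2 * a' + 3 * b' := by exact_mod_cast h₂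
  have l : (7 / 5 : ℝ) < √2 := Real.lt_sqrt_of_sq_lt (by norm_num)
  have u : √2 < 3 / 2 := (Real.sqrt_lt' (by norm_num)).2 (by norm_num)
  -- The difference is affine in `√2` and positive at both `7 / 5` and `3 / 2`, hence in between.
  nlinarith [mul_pos (sub_pos.2 h₁') (sub_pos.2 u), mul_pos (sub_pos.2 h₂') (sub_pos.2 l)]

/-- The integral certificate that the functional `F` separates the edges `i` and `j` of the closed
polygon with vertices `A k + B k √2`. -/
def SeparationCertificate {n : ℕ} [NeZero n] (A B : Fin n → Fin d → ℤ) (F : Fin d → ℤ)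
    (i j : Fin n) : Prop :=
  ∀ a, a = i ∨ a = i + 1 → ∀ b, b = j ∨ b = j + 1 → a ≠ b →
    5 * (∑ c, F c * A a c) + 7 * (∑ c, F c * B a c) <
      5 * (∑ c, F c * A b c) + 7 * (∑ c, F c * B b c) ∧
    2 * (∑ c, F c * A a c) + 3 * (∑ c, F c * B a c) <
      2 * (∑ c, F c * A b c) + 3 * (∑ c, F c * B b c)

instance {n : ℕ} [NeZero n] (A B : Fin n → Fin d → ℤ) (F : Fin d → ℤ) (i j : Fin n) :
    Decidable (SeparationCertificate A B F i j) := by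
  unfold SeparationCertificate
  infer_instance

theorem SeparationCertificate.lt {n : ℕ} [NeZero n] {A B : Fin n → Fin d → ℤ} {F : Fin d → ℤ}
    {i j : Fin n} (h : SeparationCertificate A B F i j) {a b : Fin n} (ha : a = i ∨ a = i + 1)
    (hb : b = j ∨ b = j + 1) (hab : a ≠ b) :
    integerFunctional F (quadraticPoint (A a) (B a)) <
      integerFunctional F (quadraticPoint (A b) (B b)) := by
  rw [integerFunctional_quadraticPoint, integerFunctional_quadraticPoint]
  exact quadratic_lt_of_int (h a ha b hb hab).1 (h a ha b hb hab).2

end quadraticPoints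

/-! ### The explicit space octagon and its isotopy to the model. -/

/-- The rational parts of the vertices of the space octagon. -/
def octagonA : Fin 8 → Fin 3 → ℤ :=
  ![![0, 0, 0], ![0, 0, 5], ![0, 0, -3], ![0, 0, 2],
    ![3, -3, 1], ![6, 0, 0], ![6, 0, 2], ![3, 3, 1]]

/-- The coefficients of `√2` in the vertices of the space octagon. -/
def octagonB : Fin 8 → Fin 3 → ℤ :=
  ![![0, 0, 0], ![3, 0, 0], ![3, 3, 0], ![0, 3, 0],
    ![0, 3, 0], ![0, 3, 0], ![0, 0, 0], ![0, 0, 0]]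

/-- The integral coordinates of `figureEightVertices`. -/
def figureEightInt : Fin 8 → Fin 3 → ℤ :=
  ![![0, 0, -1], ![3, 0, 3], ![3, 3, -3], ![0, 3, 1],
    ![2, 1, 0], ![4, 3, -1], ![4, 0, 1], ![2, 2, 0]]

/-- Functionals separating the edges of the space octagon and of the model. -/
def spaceFunctional (i j : Fin 8) : Fin 3 → ℤ :=
  (![![0, ![1, 1, 0], ![0, 1, 0], ![0, 1, 0], ![0, 1, 0], ![1, 0, 0], ![1, 0, -1], ![0, 1, -1]],
    ![0, 0, ![-1, 1, 0], ![-1, 0, 0], ![-12, 15, 8], ![1, 0, 0], ![-12, -15, -8], ![-1, 0, 0]],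
    ![0, 0, 0, ![0, -1, 1], ![1, -1, 0], ![1, 0, 0], ![0, -1, 0], ![0, -1, 0]],
    ![0, 0, 0, 0, ![0, 0, -1], ![1, 0, 0], ![1, 1, 0], ![0, 1, -3]],
    ![0, 0, 0, 0, 0, ![1, 0, 1], ![0, 1, 3], ![-1, 1, 0]],
    ![0, 0, 0, 0, 0, 0, ![-1, 0, 1], ![-1, 0, 0]],
    ![0, 0, 0, 0, 0, 0, 0, ![-1, 0, 0]],
    ![0, 0, 0, 0, 0, 0, 0, 0]] : Fin 8 → Fin 8 → Fin 3 → ℤ) i j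

/-- Functionals separating the edges of the plane octagon that do not cross. -/
def planeFunctional (i j : Fin 8) : Fin 2 → ℤ :=
  (![![0, ![1, 1], ![0, 1], ![0, 1], ![0, 1], ![1, 0], ![1, 1], ![-1, 2]],
    ![0, 0, ![-1, 1], ![-1, 0], 0, ![1, 0], 0, ![-1, 0]],
    ![0, 0, 0, ![-1, -2], ![1, -1], ![1, 0], ![0, -1], ![0, -1]],
    ![0, 0, 0, 0, ![1, 0], ![1, 0], ![1, 1], 0],
    ![0, 0, 0, 0, 0, ![2, -1], 0, ![-1, 1]],
    ![0, 0, 0, 0, 0, 0, ![-2, -1], ![-1, 0]],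
    ![0, 0, 0, 0, 0, 0, 0, ![-1, 0]],
    ![0, 0, 0, 0, 0, 0, 0, 0]] : Fin 8 → Fin 8 → Fin 2 → ℤ) i j

set_option maxRecDepth 4000 in
theorem space_certificate : ∀ i j, i < j →
    SeparationCertificate octagonA octagonB (spaceFunctional i j) i j ∧
    SeparationCertificate figureEightInt 0 (spaceFunctional i j) i j := by
  decide +kernel

/-- The pairs of edges of the plane octagon that cross. -/
def crossingPairs : Finset (Fin 8 × Fin 8) := {(1, 4), (1, 6), (3, 7), (4, 6)}

/-- The zero entries of `planeFunctional` above the diagonal sit exactly at `crossingPairs`, where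
no separation is possible. -/
theorem plane_certificate : ∀ i j, i < j → (i, j) ∉ crossingPairs →
    SeparationCertificate (fun k c => octagonA k c.castSucc) (fun k c => octagonB k c.castSucc)
      (planeFunctional i j) i j := by
  decide +kernel

/-- The vertices of a closed polygon in space whose edges project to the edge vectors of a regular
octagon, and that is isotopic to `figureEightVertices` by moving the vertices along segments. -/
noncomputable def octagonKnot (k : Fin 8) : EuclideanSpace ℝ (Fin 3) :=
  quadraticPoint (octagonA k) (octagonB k)

/-- The vertices of the projection of `octagonKnot`. -/
noncomputable def octagonDiagram (k : Fin 8) : EuclideanSpace ℝ (Fin 2) :=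
  quadraticPoint (fun c => octagonA k c.castSucc) (fun c => octagonB k c.castSucc)

theorem proj_octagonKnot (k : Fin 8) : proj (octagonKnot k) = octagonDiagram k := by
  ext c
  fin_cases c <;> rfl

theorem figureEightVertices_eq (k : Fin 8) :
    figureEightVertices k = quadraticPoint (figureEightInt k) (0 : Fin 3 → ℤ) := by
  ext c
  fin_cases k <;> fin_cases c <;> simp [figureEightVertices, figureEightInt, quadraticPoint]

theorem separatedEdges_octagonDiagram {i j : Fin 8} (h : i < j) (h' : (i, j) ∉ crossingPairs) :
    SeparatedEdges octagonDiagram i j :=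
  ⟨_, fun _ ha _ hb hab => (plane_certificate i j h h').lt ha hb hab⟩

theorem isSeparatedPolygon_octagonKnot_segment {t : ℝ} (ht : t ∈ Set.Icc (0 : ℝ) 1) :
    IsSeparatedPolygon fun k => (1 - t) • octagonKnot k + t • figureEightVertices k := by
  intro i j hij
  refine ⟨integerFunctional (spaceFunctional i j), fun a ha b hb hab => ?_⟩
  have h₁ := (space_certificate i j hij).1.lt ha hb hab
  have h₂ := (space_certificate i j hij).2.lt ha hb hab
  simp only [figureEightVertices_eq, octagonKnot, map_add, map_smul, smul_eq_mul]
  -- Strictness comes from the model when `t > 0` and from the octagon when `t = 0`.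
  rcases ht.1.eq_or_lt with rfl | ht0
  · simpa using h₁
  · exact add_lt_add_of_le_of_lt (mul_le_mul_of_nonneg_left h₁.le (sub_nonneg.2 ht.2))
      (mul_lt_mul_of_pos_left h₂ ht0)

theorem isSeparatedPolygon_octagonKnot : IsSeparatedPolygon octagonKnot := by
  simpa using isSeparatedPolygon_octagonKnot_segment (t := 0) (by simp)

theorem isFigureEightKnot_octagonKnot : IsFigureEightKnot (polygon octagonKnot) := by
  have h := ambientIsotopic_of_isPreconnected (convex_Icc (0 : ℝ) 1).isPreconnected
    (Q := fun (t : ℝ) k => (1 - t) • octagonKnot k + t • figureEightVertices k) (by fun_prop)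
    (fun t ht => isSeparatedPolygon_octagonKnot_segment ht)
    (fun t ht i => (isSeparatedPolygon_octagonKnot_segment ht).ne_add_one i)
    (Set.left_mem_Icc.2 zero_le_one) (Set.right_mem_Icc.2 zero_le_one)
  simpa [IsFigureEightKnot] using h

/-! ### Rotation and scaling of the horizontal coordinates. -/

/-- The rotation and scaling of the plane given by multiplication by the complex number `z`. -/
noncomputable def rotPlane (z : ℂ) : EuclideanSpace ℝ (Fin 2) →ₗ[ℝ] EuclideanSpace ℝ (Fin 2) where
  toFun x := !₂[z.re * x 0 - z.im * x 1, z.im * x 0 + z.re * x 1]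
  map_add' x y := by ext c; fin_cases c <;> simp <;> ring
  map_smul' a x := by ext c; fin_cases c <;> simp <;> ring

/-- The action of `rotPlane z` on the horizontal coordinates of space. -/
noncomputable def rotSpace (z : ℂ) : EuclideanSpace ℝ (Fin 3) →ₗ[ℝ] EuclideanSpace ℝ (Fin 3) where
  toFun x := !₂[z.re * x 0 - z.im * x 1, z.im * x 0 + z.re * x 1, x 2]
  map_add' x y := by ext c; fin_cases c <;> simp <;> ring
  map_smul' a x := by ext c; fin_cases c <;> simp <;> ring

theorem proj_rotSpace (z : ℂ) (x : EuclideanSpace ℝ (Fin 3)) :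
    proj (rotSpace z x) = rotPlane z (proj x) := by
  ext c
  fin_cases c <;> rfl

theorem rotSpace_apply_two (z : ℂ) (x : EuclideanSpace ℝ (Fin 3)) : rotSpace z x 2 = x 2 := rfl

/-- The determinant of the system is `a ^ 2 + b ^ 2`. -/
theorem rotation_eq_zero {a b x y : ℝ} (h : a ≠ 0 ∨ b ≠ 0) (h₁ : a * x - b * y = 0)
    (h₂ : b * x + a * y = 0) : x = 0 ∧ y = 0 := by
  have hpos : a ^ 2 + b ^ 2 ≠ 0 := by rcases h with h | h <;> positivity
  constructor
  · refine (mul_eq_zero.1 (?_ : (a ^ 2 + b ^ 2) * x = 0)).resolve_left hpos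
    linear_combination a * h₁ + b * h₂
  · refine (mul_eq_zero.1 (?_ : (a ^ 2 + b ^ 2) * y = 0)).resolve_left hpos
    linear_combination a * h₂ - b * h₁

theorem rotPlane_injective {z : ℂ} (hz : z ≠ 0) : Function.Injective (rotPlane z) := by
  refine (injective_iff_map_eq_zero _).2 fun x hx => ?_
  have hz' : z.re ≠ 0 ∨ z.im ≠ 0 := by
    by_contra! h
    exact hz (Complex.ext h.1 h.2)
  obtain ⟨h0, h1⟩ := rotation_eq_zero hz' (congrArg (fun v => v 0) hx) (congrArg (fun v => v 1) hx)
  ext c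
  fin_cases c
  exacts [h0, h1]

theorem rotSpace_injective {z : ℂ} (hz : z ≠ 0) : Function.Injective (rotSpace z) := by
  refine (injective_iff_map_eq_zero _).2 fun x hx => ?_
  have h : proj x = 0 := (injective_iff_map_eq_zero _).1 (rotPlane_injective hz) _ <| by
    rw [← proj_rotSpace, hx]
    ext c
    fin_cases c <;> rfl
  ext c
  fin_cases c
  exacts [congrArg (fun v => v 0) h, congrArg (fun v => v 1) h, congrArg (fun v => v 2) hx]

theorem rotSpace_one (x : EuclideanSpace ℝ (Fin 3)) : rotSpace 1 x = x := by
  ext c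
  fin_cases c <;> simp [rotSpace]

theorem isSeparatedPolygon_rotSpace_octagonKnot {z : ℂ} (hz : z ≠ 0) :
    IsSeparatedPolygon fun k => rotSpace z (octagonKnot k) := fun i j hij =>
  (isSeparatedPolygon_octagonKnot i j hij).comp (rotSpace_injective hz)

theorem isFigureEightKnot_rotSpace_octagonKnot {z : ℂ} (hz : z ≠ 0) :
    IsFigureEightKnot (polygon fun k => rotSpace z (octagonKnot k)) := by
  have hS : IsPreconnected ({0}ᶜ : Set ℂ) :=
    (isConnected_compl_singleton_of_one_lt_rank (by simp) 0).isPreconnected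
  have hc : Continuous fun (w : ℂ) k => rotSpace w (octagonKnot k) := by
    refine continuous_pi fun k => (PiLp.continuous_toLp 2 _).comp (continuous_pi fun c => ?_)
    have := Complex.continuous_re
    have := Complex.continuous_im
    fin_cases c <;> simp <;> fun_prop
  have h := ambientIsotopic_of_isPreconnected hS hc
    (fun w hw => isSeparatedPolygon_rotSpace_octagonKnot hw)
    (fun w hw i => (isSeparatedPolygon_rotSpace_octagonKnot hw).ne_add_one i)
    (x := z) (y := 1) hz (by simp)
  simp only [rotSpace_one] at h
  exact h.trans isFigureEightKnot_octagonKnot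

/-! ### The four crossings and their order. -/

/-- The parameters at which `octagonKnot` passes over itself, in the order of tracing. -/
noncomputable def overParam : Fin 4 → Fin 8 × ℝ :=
  ![(1, √2 - 1), (3, √2 / 2), (4, √2 - 1), (6, √2 / 2)]

/-- The parameters at which `octagonKnot` passes under itself, in the order of tracing. -/
noncomputable def underParam : Fin 4 → Fin 8 × ℝ :=
  ![(1, 2 - √2), (4, 1 - √2 / 2), (6, 2 - √2), (7, 1 - √2 / 2)]

theorem sqrt_two_bounds : 1.41 < √2 ∧ √2 < 1.42 :=
  ⟨Real.lt_sqrt_of_sq_lt (by norm_num), (Real.sqrt_lt' (by norm_num)).2 (by norm_num)⟩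

theorem overParam_mem (k : Fin 4) : overParam k ∈ polyParams 8 ∧ (overParam k).2 ≠ 0 := by
  obtain ⟨h₁, h₂⟩ := sqrt_two_bounds
  fin_cases k <;> refine ⟨⟨?_, ?_⟩, ne_of_gt ?_⟩ <;> norm_num [overParam] <;> linarith

theorem underParam_mem (k : Fin 4) : underParam k ∈ polyParams 8 ∧ (underParam k).2 ≠ 0 := by
  obtain ⟨h₁, h₂⟩ := sqrt_two_bounds
  fin_cases k <;> refine ⟨⟨?_, ?_⟩, ne_of_gt ?_⟩ <;> norm_num [underParam] <;> linarith

/-- With the next lemma this says that the eight passages occur as over 0, under 0, over 1, under 1,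
and so on; every other order fact follows by transitivity. -/
theorem before_overParam_underParam {k l : Fin 4} (h : k ≤ l) :
    Before (overParam k) (underParam l) := by
  obtain ⟨h₁, h₂⟩ := sqrt_two_bounds
  fin_cases k <;> fin_cases l <;>
    simp [overParam, underParam, Before] at h ⊢ <;> linarith

theorem before_underParam_overParam {k l : Fin 4} (h : k < l) :
    Before (underParam k) (overParam l) := by
  obtain ⟨h₁, h₂⟩ := sqrt_two_bounds
  fin_cases k <;> fin_cases l <;> simp [overParam, underParam, Before] at h ⊢ <;> linarith

theorem Before.trans {n : ℕ} {p q r : Fin n × ℝ} (h₁ : Before p q) (h₂ : Before q r) :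
    Before p r := by
  simp only [Before] at *
  rcases h₁ with h₁ | ⟨h₁, h₁'⟩ <;> rcases h₂ with h₂ | ⟨h₂, h₂'⟩
  · exact Or.inl (h₁.trans h₂)
  · exact Or.inl (h₂ ▸ h₁)
  · exact Or.inl (h₁ ▸ h₂)
  · exact Or.inr ⟨h₁.trans h₂, h₁'.trans h₂'⟩

theorem Before.irrefl {n : ℕ} {p : Fin n × ℝ} : ¬ Before p p := by simp [Before]

theorem Before.ne {n : ℕ} {p q : Fin n × ℝ} (h : Before p q) : p ≠ q := fun he =>
  Before.irrefl (he ▸ h)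

theorem before_overParam {k l : Fin 4} (h : k < l) : Before (overParam k) (overParam l) :=
  (before_overParam_underParam le_rfl).trans (before_underParam_overParam h)

theorem before_underParam {k l : Fin 4} (h : k < l) : Before (underParam k) (underParam l) :=
  (before_underParam_overParam h).trans (before_overParam_underParam le_rfl)

theorem lt_of_before_overParam {k l : Fin 4} (h : Before (overParam k) (overParam l)) : k < l := by
  by_contra! hlk
  rcases hlk.eq_or_lt with rfl | hlk
  · exact h.irrefl
  · exact (h.trans (before_overParam hlk)).irrefl

theorem lt_of_before_underParam {k l : Fin 4} (h : Before (underParam k) (underParam l)) :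
    k < l := by
  by_contra! hlk
  rcases hlk.eq_or_lt with rfl | hlk
  · exact h.irrefl
  · exact (h.trans (before_underParam hlk)).irrefl

theorem overParam_injective : Function.Injective overParam := by
  intro k l h
  by_contra hkl
  rcases lt_or_gt_of_ne hkl with hkl | hkl
  exacts [(before_overParam hkl).ne h, (before_overParam hkl).ne h.symm]

theorem underParam_injective : Function.Injective underParam := by
  intro k l h
  by_contra hkl
  rcases lt_or_gt_of_ne hkl with hkl | hkl
  exacts [(before_underParam hkl).ne h, (before_underParam hkl).ne h.symm]

theorem overParam_ne_underParam (k l : Fin 4) : overParam k ≠ underParam l := by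
  rcases le_or_gt k l with h | h
  exacts [(before_overParam_underParam h).ne, (before_underParam_overParam h).ne.symm]

/-- The shift by `2` modulo `4` is the matching between the two lists: over passage `k` lies above
under passage `k + 2`. -/
theorem polyPoint_octagonKnot_crossing (k : Fin 4) :
    proj (polyPoint octagonKnot (overParam k)) = proj (polyPoint octagonKnot (underParam (k + 2))) ∧
    polyPoint octagonKnot (underParam (k + 2)) 2 < polyPoint octagonKnot (overParam k) 2 := by
  obtain ⟨h₁, h₂⟩ := sqrt_two_bounds
  have hs : √2 ^ 2 = 2 := Real.sq_sqrt (by norm_num)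
  constructor
  · ext c
    fin_cases k <;> fin_cases c <;>
      simp [proj, polyPoint, octagonKnot, quadraticPoint, octagonA, octagonB, overParam,
        underParam] <;> linarith
  · fin_cases k <;>
      simp [polyPoint, octagonKnot, quadraticPoint, octagonA, octagonB, overParam,
        underParam] <;> linarith

theorem linearIndependent_octagonDiagram_crossing (k : Fin 4) :
    LinearIndependent ℝ ![
      octagonDiagram ((overParam k).1 + 1) - octagonDiagram (overParam k).1,
      octagonDiagram ((underParam (k + 2)).1 + 1) - octagonDiagram (underParam (k + 2)).1] := by
  rw [LinearIndependent.pair_iff]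
  intro a b h
  have h0 := congrArg (fun v => v 0) h
  have h1 := congrArg (fun v => v 1) h
  fin_cases k <;>
    simp [octagonDiagram, quadraticPoint, octagonA, octagonB, overParam, underParam] at h0 h1
  · have hb : b = 0 := h0.resolve_right (by norm_num)
    exact ⟨by simpa [hb] using h1, hb⟩
  · constructor <;> linarith
  · have ha : a = 0 := h0.resolve_right (by norm_num)
    exact ⟨ha, by simpa [ha] using h1⟩
  · constructor <;> linarith

theorem octagonDiagram_coincidence {p q : Fin 8 × ℝ} (hlt : p.1 < q.1)
    (hp : p ∈ polyParams 8) (hq : q ∈ polyParams 8)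
    (h : polyPoint octagonDiagram p = polyPoint octagonDiagram q) :
    ∃ k, p = overParam k ∧ q = underParam (k + 2) ∨ p = underParam (k + 2) ∧ q = overParam k := by
  by_cases hpq : (p.1, q.1) ∈ crossingPairs
  · have hs : √2 ^ 2 = 2 := Real.sq_sqrt (by norm_num)
    obtain ⟨i, s⟩ := p
    obtain ⟨j, t⟩ := q
    have h0 := congrArg (fun v => v 0) h
    have h1 := congrArg (fun v => v 1) h
    simp only [crossingPairs, Finset.mem_insert, Finset.mem_singleton, Prod.mk.injEq] at hpq
    rcases hpq with ⟨rfl, rfl⟩ | ⟨rfl, rfl⟩ | ⟨rfl, rfl⟩ | ⟨rfl, rfl⟩ <;>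
      simp [polyPoint, octagonDiagram, quadraticPoint, octagonA, octagonB] at h0 h1
    -- Edge 1 is vertical, so the first coordinate determines the parameter on the other edge. The
    -- factor `√2 / 6` is the inverse of the edge length `3√2`.
    · obtain rfl : t = √2 - 1 := by linarith
      obtain rfl : s = 2 - √2 := by linear_combination √2 / 6 * h1 + (1 - s / 2) * hs
      exact ⟨2, Or.inr ⟨rfl, rfl⟩⟩
    · obtain rfl : t = 2 - √2 := by linarith
      obtain rfl : s = √2 - 1 := by linear_combination √2 / 6 * h1 - (s + 1) / 2 * hs
      exact ⟨0, Or.inl ⟨rfl, rfl⟩⟩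
    · obtain rfl : s = √2 / 2 := by linarith
      obtain rfl : t = 1 - √2 / 2 := by linarith
      exact ⟨1, Or.inl ⟨rfl, rfl⟩⟩
    · obtain rfl : t = √2 / 2 := by linarith
      obtain rfl : s = 1 - √2 / 2 := by linarith
      exact ⟨3, Or.inr ⟨rfl, rfl⟩⟩
  · exact absurd h ((separatedEdges_octagonDiagram hlt hpq).polyPoint_ne hlt.ne hp hq)

/-- The self-intersections of `octagonDiagram` are the four crossings. -/
theorem polyPoint_octagonDiagram_eq {p q : Fin 8 × ℝ} (hne : p ≠ q)
    (hp : p ∈ polyParams 8) (hq : q ∈ polyParams 8)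
    (h : polyPoint octagonDiagram p = polyPoint octagonDiagram q) :
    ∃ k, p = overParam k ∧ q = underParam (k + 2) ∨ p = underParam (k + 2) ∧ q = overParam k := by
  rcases lt_trichotomy p.1 q.1 with hlt | heq | hlt
  · exact octagonDiagram_coincidence hlt hp hq h
  · obtain ⟨i, s⟩ := p
    obtain ⟨j, t⟩ := q
    obtain rfl : i = j := heq
    have hi : octagonDiagram i ≠ octagonDiagram (i + 1) := by
      have key (a b : Fin 8) (hab : a < b) (h' : (a, b) ∉ crossingPairs) :
          octagonDiagram a ≠ octagonDiagram b := fun he => by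
        obtain ⟨f, hf⟩ := separatedEdges_octagonDiagram hab h'
        exact (hf a (Or.inl rfl) b (Or.inl rfl) hab.ne).ne (congrArg f he)
      have h₁ : ∀ i : Fin 8, (i, i + 1) ∉ crossingPairs := by decide
      have h₂ : ∀ i : Fin 8, i + 1 ≤ i → i = 7 := by decide
      rcases lt_or_ge i (i + 1) with hi | hi
      · exact key i (i + 1) hi (h₁ i)
      -- Cyclic wrap-around: the successor of vertex 7 is vertex 0.
      · obtain rfl := h₂ i hi
        exact (key 0 7 (by decide) (by decide)).symm
    exact absurd (by rw [polyPoint_injective_edge hi h]) hne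
  · obtain ⟨k, hk⟩ := octagonDiagram_coincidence hlt hq hp h.symm
    exact ⟨k, hk.symm.imp And.symm And.symm⟩

/-! ### The diagram and the knot after rotation and scaling. -/

section image

variable {z : ℂ}

theorem proj_polyPoint_rotSpace (z : ℂ) (p : Fin 8 × ℝ) :
    proj (polyPoint (fun k => rotSpace z (octagonKnot k)) p) =
      rotPlane z (polyPoint octagonDiagram p) := by
  rw [polyPoint_comp, proj_rotSpace]
  congr 1
  ext c
  fin_cases c <;> simp [proj, polyPoint, ← proj_octagonKnot]

theorem polyPoint_octagonDiagram_crossing (k : Fin 4) :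
    polyPoint octagonDiagram (overParam k) = polyPoint octagonDiagram (underParam (k + 2)) := by
  apply rotPlane_injective one_ne_zero
  rw [← proj_polyPoint_rotSpace, ← proj_polyPoint_rotSpace, polyPoint_comp, polyPoint_comp,
    rotSpace_one, rotSpace_one]
  exact (polyPoint_octagonKnot_crossing k).1

theorem polyPoint_rotPlane_eq_iff (hz : z ≠ 0) (p q : Fin 8 × ℝ) :
    polyPoint (fun k => rotPlane z (octagonDiagram k)) p =
      polyPoint (fun k => rotPlane z (octagonDiagram k)) q ↔
    polyPoint octagonDiagram p = polyPoint octagonDiagram q := by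
  rw [polyPoint_comp, polyPoint_comp, (rotPlane_injective hz).eq_iff]

theorem linearIndependent_pair_map {E F : Type*} [AddCommGroup E] [Module ℝ E] [AddCommGroup F]
    [Module ℝ F] {A : E →ₗ[ℝ] F} (hA : Function.Injective A) {x y : E}
    (h : LinearIndependent ℝ ![x, y]) : LinearIndependent ℝ ![A x, A y] := by
  rw [LinearIndependent.pair_iff] at h ⊢
  exact fun s t hst => h s t (hA (by simpa using hst))

theorem isRegularProjection_rotPlane (hz : z ≠ 0) :
    IsRegularProjection fun k => rotPlane z (octagonDiagram k) := by
  intro p hp q hq hne h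
  rw [polyPoint_rotPlane_eq_iff hz] at h
  have hind (k : Fin 4) : LinearIndependent ℝ ![
      rotPlane z (octagonDiagram ((overParam k).1 + 1)) - rotPlane z (octagonDiagram (overParam k).1),
      rotPlane z (octagonDiagram ((underParam (k + 2)).1 + 1)) -
        rotPlane z (octagonDiagram (underParam (k + 2)).1)] := by
    simpa only [map_sub] using
      linearIndependent_pair_map (rotPlane_injective hz) (linearIndependent_octagonDiagram_crossing k)
  simp only [polyPoint_rotPlane_eq_iff hz]
  obtain ⟨k, ⟨rfl, rfl⟩ | ⟨rfl, rfl⟩⟩ := polyPoint_octagonDiagram_eq hne hp hq h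
  · refine ⟨(overParam_mem _).2, (underParam_mem _).2, hind k, fun s hs hsp => ?_⟩
    -- A third passage would give another crossing at the same parameter, but each passage belongs
    -- to only one crossing.
    by_contra! hs'
    obtain ⟨l, ⟨-, h2⟩ | ⟨h1, h2⟩⟩ := polyPoint_octagonDiagram_eq hs'.1 hs hp hsp
    · exact overParam_ne_underParam _ _ h2
    · rw [overParam_injective h2] at hs'
      exact hs'.2 h1
  · refine ⟨(underParam_mem _).2, (overParam_mem _).2,
      LinearIndependent.pair_symm_iff.1 (hind k), fun s hs hsp => ?_⟩
    by_contra! hs'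
    obtain ⟨l, ⟨h1, h2⟩ | ⟨-, h2⟩⟩ := polyPoint_octagonDiagram_eq hs'.1 hs hp hsp
    · rw [add_right_cancel (underParam_injective h2)] at hs'
      exact hs'.2 h1
    · exact overParam_ne_underParam _ _ h2.symm

theorem ncard_crossings_rotPlane (hz : z ≠ 0) :
    (crossings fun k => rotPlane z (octagonDiagram k)).ncard = 4 := by
  have hrange : crossings (fun k => rotPlane z (octagonDiagram k)) =
      Set.range fun k => polyPoint (fun k => rotPlane z (octagonDiagram k)) (overParam k) := by
    ext x
    constructor
    · rintro ⟨p, hp, q, hq, hne, rfl, h⟩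
      rw [polyPoint_rotPlane_eq_iff hz] at h
      obtain ⟨k, ⟨rfl, rfl⟩ | ⟨rfl, rfl⟩⟩ := polyPoint_octagonDiagram_eq hne hp hq h.symm
      · exact ⟨k, rfl⟩
      · exact ⟨k, (polyPoint_rotPlane_eq_iff hz _ _).2 h⟩
    · rintro ⟨k, rfl⟩
      exact ⟨_, (overParam_mem k).1, _, (underParam_mem (k + 2)).1, overParam_ne_underParam _ _, rfl,
        (polyPoint_rotPlane_eq_iff hz _ _).2 (polyPoint_octagonDiagram_crossing k).symm⟩
  -- Coincidences always pair an over with an under passage, so two over passages never meet in the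
  -- plane.
  have hinj : Function.Injective fun k =>
      polyPoint (fun k => rotPlane z (octagonDiagram k)) (overParam k) := by
    intro k l h
    replace h := (polyPoint_rotPlane_eq_iff hz _ _).1 h
    by_contra hkl
    obtain ⟨m, ⟨-, h2⟩ | ⟨h1, -⟩⟩ := polyPoint_octagonDiagram_eq (overParam_injective.ne hkl)
      (overParam_mem k).1 (overParam_mem l).1 h
    · exact overParam_ne_underParam _ _ h2
    · exact overParam_ne_underParam _ _ h1
  rw [hrange, ← Set.image_univ, Set.ncard_image_of_injective _ hinj, Set.ncard_univ]
  simp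

theorem polyPoint_rotSpace_underParam_lt (z : ℂ) (k : Fin 4) :
    polyPoint (fun k => rotSpace z (octagonKnot k)) (underParam (k + 2)) 2 <
      polyPoint (fun k => rotSpace z (octagonKnot k)) (overParam k) 2 := by
  rw [polyPoint_comp, polyPoint_comp, rotSpace_apply_two, rotSpace_apply_two]
  exact (polyPoint_octagonKnot_crossing k).2

theorem isOver_rotSpace_iff (hz : z ≠ 0) (p : Fin 8 × ℝ) :
    IsOver (fun k => rotSpace z (octagonKnot k)) p ↔ ∃ k, p = overParam k := by
  simp only [IsOver, proj_polyPoint_rotSpace, (rotPlane_injective hz).eq_iff]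
  constructor
  · rintro ⟨hp, q, hq, hne, h, hlt⟩
    obtain ⟨k, ⟨rfl, -⟩ | ⟨rfl, rfl⟩⟩ := polyPoint_octagonDiagram_eq hne hp hq h
    · exact ⟨k, rfl⟩
    · exact absurd hlt (polyPoint_rotSpace_underParam_lt z k).asymm
  · rintro ⟨k, rfl⟩
    exact ⟨(overParam_mem k).1, _, (underParam_mem (k + 2)).1, overParam_ne_underParam _ _,
      polyPoint_octagonDiagram_crossing k, polyPoint_rotSpace_underParam_lt z k⟩

theorem isUnder_rotSpace_iff (hz : z ≠ 0) (p : Fin 8 × ℝ) :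
    IsUnder (fun k => rotSpace z (octagonKnot k)) p ↔ ∃ k, p = underParam k := by
  simp only [IsUnder, proj_polyPoint_rotSpace, (rotPlane_injective hz).eq_iff]
  constructor
  · rintro ⟨hp, q, hq, hne, h, hlt⟩
    obtain ⟨k, ⟨rfl, rfl⟩ | ⟨rfl, -⟩⟩ := polyPoint_octagonDiagram_eq hne hp hq h
    · exact absurd hlt (polyPoint_rotSpace_underParam_lt z k).asymm
    · exact ⟨k + 2, rfl⟩
  · rintro ⟨k, rfl⟩
    obtain ⟨k, rfl⟩ : ∃ l, k = l + 2 := ⟨k - 2, by simp⟩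
    exact ⟨(underParam_mem _).1, _, (overParam_mem k).1, (overParam_ne_underParam _ _).symm,
      (polyPoint_octagonDiagram_crossing k).symm, polyPoint_rotSpace_underParam_lt z k⟩

/-- A self-intersection in space would project to a crossing, where the two heights differ. -/
theorem isSimplePolygon_rotSpace (hz : z ≠ 0) :
    IsSimplePolygon fun k => rotSpace z (octagonKnot k) := by
  intro p hp q hq h
  by_contra hne
  have h' := congrArg proj h
  rw [proj_polyPoint_rotSpace, proj_polyPoint_rotSpace, (rotPlane_injective hz).eq_iff] at h'
  obtain ⟨k, ⟨rfl, rfl⟩ | ⟨rfl, rfl⟩⟩ := polyPoint_octagonDiagram_eq hne hp hq h'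
  · exact (polyPoint_rotSpace_underParam_lt z k).ne (by rw [h])
  · exact (polyPoint_rotSpace_underParam_lt z k).ne (by rw [h])

theorem isAlternating_rotSpace (hz : z ≠ 0) :
    IsAlternating fun k => rotSpace z (octagonKnot k) := by
  intro p q hpq
  simp only [isOver_rotSpace_iff hz, isUnder_rotSpace_iff hz]
  constructor
  · rintro ⟨k, rfl⟩ ⟨l, rfl⟩
    have hkl := lt_of_before_overParam hpq
    exact ⟨⟨_, ⟨k, rfl⟩, before_overParam_underParam le_rfl, before_underParam_overParam hkl⟩,
      ⟨_, ⟨3, rfl⟩, Or.inr (before_overParam_underParam (Fin.le_last l))⟩⟩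
  · rintro ⟨k, rfl⟩ ⟨l, rfl⟩
    have hkl := lt_of_before_underParam hpq
    exact ⟨⟨_, ⟨l, rfl⟩, before_underParam_overParam hkl, before_overParam_underParam le_rfl⟩,
      ⟨_, ⟨0, rfl⟩, Or.inl (before_overParam_underParam (Fin.zero_le k))⟩⟩

end image

/-! ### Placing edges tip to tail, and the edge vectors of a regular octagon. -/

theorem tipToTail_zero {E : Type*} [AddCommGroup E] {n : ℕ} (v : Fin (n + 1) → E) :
    tipToTail v 0 = 0 :=
  Finset.sum_eq_zero fun j hj => absurd (Finset.mem_Iio.1 hj) (Fin.not_lt_zero j)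

theorem tipToTail_succ {E : Type*} [AddCommGroup E] {n : ℕ} (v : Fin (n + 1) → E) (k : Fin n) :
    tipToTail v k.succ = tipToTail v k.castSucc + v k.castSucc := by
  have h : Finset.Iio k.succ = insert k.castSucc (Finset.Iio k.castSucc) := by
    ext j
    simp only [Finset.mem_Iio, Finset.mem_insert, Fin.lt_def, Fin.ext_iff, Fin.val_succ,
      Fin.val_castSucc]
    omega
  rw [tipToTail, h, Finset.sum_insert (by simp), add_comm, tipToTail]

/-- The polygon with the edges of `Q` placed tip to tail is the translate of `Q` starting
at `0`. -/
theorem tipToTail_edges {E : Type*} [AddCommGroup E] {n : ℕ} (Q : Fin (n + 1) → E) :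
    (tipToTail fun k => Q (k + 1) - Q k) = fun k => Q k - Q 0 := by
  funext k
  induction k using Fin.induction with
  | zero => simp [tipToTail_zero]
  | succ k ih =>
    rw [tipToTail_succ, ih, Fin.coeSucc_eq_succ]
    abel

theorem sum_edges_eq_zero {E : Type*} [AddCommGroup E] {n : ℕ} [NeZero n] (Q : Fin n → E) :
    ∑ k, (Q (k + 1) - Q k) = 0 := by
  rw [Finset.sum_sub_distrib, sub_eq_zero]
  exact Fintype.sum_equiv (Equiv.addRight (1 : Fin n)) _ _ fun _ => rfl

/-- The order in which the edge vectors of the regular octagon are placed. -/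
def octagonOrder : Equiv.Perm (Fin 8) where
  toFun := ![0, 2, 4, 7, 1, 6, 3, 5]
  invFun := ![0, 4, 1, 6, 2, 7, 5, 3]
  left_inv := by decide
  right_inv := by decide

/-- Numbering the edges of the octagon backwards. -/
def octagonReversal : Equiv.Perm (Fin 8) where
  toFun := ![0, 7, 6, 5, 4, 3, 2, 1]
  invFun := ![0, 7, 6, 5, 4, 3, 2, 1]
  left_inv := by decide
  right_inv := by decide

theorem cos_sin_mul_pi_div_four (k : Fin 8) :
    Real.cos (((k : ℕ) : ℝ) * (Real.pi / 4)) =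
      ![1, √2 / 2, 0, -(√2 / 2), -1, -(√2 / 2), 0, √2 / 2] k ∧
    Real.sin (((k : ℕ) : ℝ) * (Real.pi / 4)) =
      ![0, √2 / 2, 1, √2 / 2, 0, -(√2 / 2), -1, -(√2 / 2)] k := by
  have hs : √2 ^ 2 = 2 := Real.sq_sqrt (by norm_num)
  induction k using Fin.induction with
  | zero => simp
  | succ k ih =>
    have h : (((k.succ : Fin 8) : ℕ) : ℝ) * (Real.pi / 4) =
        ((k.castSucc : ℕ) : ℝ) * (Real.pi / 4) + Real.pi / 4 := by
      simp
      ring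
    rw [h, Real.cos_add, Real.sin_add, ih.1, ih.2, Real.cos_pi_div_four, Real.sin_pi_div_four]
    fin_cases k <;> constructor <;> simp <;> linarith

/-- The coordinates of the vertices of a regular octagon. -/
theorem IsRegularOctagon.exists_coordinates {P : Fin 8 → EuclideanSpace ℝ (Fin 2)}
    (hP : IsRegularOctagon P) : ∃ (c : EuclideanSpace ℝ (Fin 2)) (a b ε : ℝ),
      (a ≠ 0 ∨ b ≠ 0) ∧ (ε = 1 ∨ ε = -1) ∧ ∀ k,
        P k 0 = c 0 + (a * ![1, √2 / 2, 0, -(√2 / 2), -1, -(√2 / 2), 0, √2 / 2] k -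
          b * (ε * ![0, √2 / 2, 1, √2 / 2, 0, -(√2 / 2), -1, -(√2 / 2)] k)) ∧
        P k 1 = c 1 + (b * ![1, √2 / 2, 0, -(√2 / 2), -1, -(√2 / 2), 0, √2 / 2] k +
          a * (ε * ![0, √2 / 2, 1, √2 / 2, 0, -(√2 / 2), -1, -(√2 / 2)] k)) := by
  obtain ⟨c, r, θ, ω, hr, hω, hP⟩ := hP
  -- Here `a + b i = r e^{iθ}`, and `ε` is the orientation sign.
  refine ⟨c, r * Real.cos θ, r * Real.sin θ, if ω = Real.pi / 4 then 1 else -1, ?_, ?_,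
    fun k => ?_⟩
  · by_contra! h
    have := Real.cos_sq_add_sin_sq θ
    simp [(mul_eq_zero.1 h.1).resolve_left hr.ne', (mul_eq_zero.1 h.2).resolve_left hr.ne'] at this
  · split_ifs <;> simp
  · have hπ : -(Real.pi / 4) ≠ Real.pi / 4 := by linarith [Real.pi_pos]
    rw [← (cos_sin_mul_pi_div_four k).1, ← (cos_sin_mul_pi_div_four k).2]
    rcases hω with rfl | rfl
    · simp only [hP, if_true, PiLp.add_apply, PiLp.smul_apply, Real.cos_add, Real.sin_add]
      constructor <;> simp <;> ring
    · simp only [hP, if_neg hπ, PiLp.add_apply, PiLp.smul_apply, mul_neg, Real.cos_add,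
        Real.sin_add, Real.cos_neg, Real.sin_neg]
      constructor <;> simp <;> ring

/-- The edge vectors of a regular octagon, possibly numbered backwards, are up to a rotation and
a scaling the edge vectors of `octagonDiagram`. -/
theorem IsRegularOctagon.exists_edges_eq {P : Fin 8 → EuclideanSpace ℝ (Fin 2)}
    (hP : IsRegularOctagon P) : ∃ (τ : Equiv.Perm (Fin 8)) (z : ℂ), z ≠ 0 ∧ ∀ k,
      P (τ (octagonOrder k) + 1) - P (τ (octagonOrder k)) =
        rotPlane z (octagonDiagram (k + 1) - octagonDiagram k) := by
  obtain ⟨c, a, b, ε, hab, hε, hP⟩ := hP.exists_coordinates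
  obtain ⟨l, u⟩ := sqrt_two_bounds
  have h₂ : √2 ^ 2 = 2 := Real.sq_sqrt (by norm_num)
  have h₃ : √2 ^ 3 = 2 * √2 := by rw [pow_succ, h₂]
  -- With renumbering by `k ↦ -k` in the clockwise case, edge `k` is `(a + b i)(e^{iεπ/4} - 1)
  -- e^{ikπ/4}` in both cases. Dividing the common factor by the length `3√2` of the edges of
  -- `octagonDiagram` gives `z`.
  refine ⟨if ε = 1 then Equiv.refl _ else octagonReversal,
    ⟨(a * (√2 / 2 - 1) - b * (ε * (√2 / 2))) * (√2 / 6),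
      (b * (√2 / 2 - 1) + a * (ε * (√2 / 2))) * (√2 / 6)⟩, fun hz => ?_, fun k => ?_⟩
  · have hne : √2 / 6 ≠ 0 := by positivity
    have h0 := (mul_eq_zero.1 (congrArg Complex.re hz)).resolve_right hne
    have h1 := (mul_eq_zero.1 (congrArg Complex.im hz)).resolve_right hne
    have := (rotation_eq_zero hab (x := √2 / 2 - 1) (y := ε * (√2 / 2)) h0 (by linarith)).1
    linarith
  · have hne : (-1 : ℝ) ≠ 1 := by norm_num
    ext i
    rcases hε with rfl | rfl
    · fin_cases k <;> fin_cases i <;>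
        simp [hP, rotPlane, octagonDiagram, quadraticPoint, octagonA, octagonB, octagonOrder] <;>
        ring_nf <;> simp only [h₂, h₃] <;> ring
    · fin_cases k <;> fin_cases i <;>
        simp [hP, hne, rotPlane, octagonDiagram, quadraticPoint, octagonA, octagonB,
          octagonOrder, octagonReversal] <;>
        ring_nf <;> simp only [h₂, h₃] <;> ring

theorem mainTheorem4 (P : Fin 8 → EuclideanSpace ℝ (Fin 2)) (hP : IsRegularOctagon P) :
    ∃ σ : Equiv.Perm (Fin 8),
      -- the reordered edge vectors form a plane polygon with exactly four crossings
      IsRegularProjection (tipToTail fun k => P (σ k + 1) - P (σ k)) ∧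
      (crossings (tipToTail fun k => P (σ k + 1) - P (σ k))).ncard = 4 ∧
      -- and lift to vectors in space which, in that order, form an alternating `4₁` knot
      ∃ w : Fin 8 → EuclideanSpace ℝ (Fin 3),
        (∀ k, proj (w k) = P (k + 1) - P k) ∧
        ∑ k, w k = 0 ∧
        IsSimplePolygon (tipToTail fun k => w (σ k)) ∧
        IsAlternating (tipToTail fun k => w (σ k)) ∧
        IsFigureEightKnot (polygon (tipToTail fun k => w (σ k))) := by
  obtain ⟨τ, z, hz, hv⟩ := hP.exists_edges_eq
  have hzero : octagonDiagram 0 = 0 ∧ octagonKnot 0 = 0 := by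
    constructor <;> ext i <;> fin_cases i <;>
      simp [octagonDiagram, octagonKnot, quadraticPoint, octagonA, octagonB]
  have hplane : (tipToTail fun k => P (octagonOrder.trans τ k + 1) - P (octagonOrder.trans τ k)) =
      fun k => rotPlane z (octagonDiagram k) := by
    simp only [Equiv.trans_apply, hv, map_sub]
    rw [tipToTail_edges fun k => rotPlane z (octagonDiagram k)]
    simp [hzero]
  -- The lift is indexed by the original edges, so the inverse permutation makes `w (σ k)` the
  -- `k`-th edge of the knot.
  set w : Fin 8 → EuclideanSpace ℝ (Fin 3) := fun m =>
    rotSpace z (octagonKnot ((octagonOrder.trans τ).symm m + 1)) -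
      rotSpace z (octagonKnot ((octagonOrder.trans τ).symm m)) with hw
  have hspace : (tipToTail fun k => w (octagonOrder.trans τ k)) =
      fun k => rotSpace z (octagonKnot k) := by
    simp only [hw, Equiv.symm_apply_apply]
    rw [tipToTail_edges fun k => rotSpace z (octagonKnot k)]
    simp [hzero]
  refine ⟨octagonOrder.trans τ, ?_, ?_, w, fun k => ?_, ?_, ?_, ?_, ?_⟩
  · rw [hplane]
    exact isRegularProjection_rotPlane hz
  · rw [hplane]
    exact ncard_crossings_rotPlane hz
  · obtain ⟨k, rfl⟩ := (octagonOrder.trans τ).surjective k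
    have hproj (x y : EuclideanSpace ℝ (Fin 3)) : proj (x - y) = proj x - proj y := by
      ext i
      fin_cases i <;> rfl
    simp only [hw, Equiv.symm_apply_apply, hproj, proj_rotSpace, proj_octagonKnot, ← map_sub]
    exact (hv k).symm
  · rw [← (octagonOrder.trans τ).sum_comp w]
    simp only [hw, Equiv.symm_apply_apply]
    exact sum_edges_eq_zero fun k => rotSpace z (octagonKnot k)
  · rw [hspace]
    exact isSimplePolygon_rotSpace hz
  · rw [hspace]
    exact isAlternating_rotSpace hz
  · rw [hspace]
    exact isFigureEightKnot_rotSpace_octagonKnot hz
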